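/- Let $\mathbb{Z}^{\mathbb{N}}_0$ be the group of all integer sequences with only finitely many nonzero terms, i.e. the direct sum of countably many copies of $\mathbb{Z}$. For an Abelian topological group $X$, let $X^\wedge$ be the group of all continuous characters of $X$ (continuous homomorphisms from $X$ to the circle group), endowed with the compact-open topology; $X$ is called maximally almost periodic (MAP) if the intersection of the kernels of all its continuous characters is $\{0\}$. A topological space is called sequential if every sequentially open subset of it is open, where a set $A$ is sequentially open if every sequence converging to a point of $A$ has all but finitely many of its terms in $A$. Then there is a Hausdorff group topology $\tau$ on $\mathbb{Z}^{\mathbb{N}}_0$ such that $(\mathbb{Z}^{\mathbb{N}}_0,\tau)$ is complete (with respect to its group uniformity), sequential and MAP, and $$(\mathbb{Z}^{\mathbb{N}}_0,\tau)^\wedge \cong \mathbb{R}^{\mathbb{N}}$$ as topological groups, where $\mathbb{R}^{\mathbb{N}}$ is the additive group of real sequences with the product topology. -/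

import Mathlib

/-- The group `X^∧` of all continuous characters `X → 𝕋` of an additive topological group `X`,
with pointwise multiplication and the compact-open topology. -/
abbrev DualGroup (X : Type*) [AddCommGroup X] [TopologicalSpace X] : Type _ :=
  PontryaginDual (Multiplicative X)

/-- The von Neumann radical `n(X)`: the intersection of the kernels of all continuous characters
of `X`. -/
def vonNeumannRadical (X : Type*) [AddCommGroup X] [TopologicalSpace X] : Set X :=
  ⋂ χ : DualGroup X, {x : X | χ (Multiplicative.ofAdd x) = 1}

/-- `X` is maximally almost periodic: its von Neumann radical is trivial. -/
def IsMAP (X : Type*) [AddCommGroup X] [TopologicalSpace X] : Prop :=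
  vonNeumannRadical X = {0}

/-- The topological group `X` is complete in its group uniformity: the uniformity with entourages
`{(x, y) | y - x ∈ U}`, for `U` a neighbourhood of zero. -/
def IsCompleteAddGroup (X : Type*) [AddCommGroup X] [TopologicalSpace X]
    [IsTopologicalAddGroup X] : Prop :=
  @CompleteSpace X (IsTopologicalAddGroup.rightUniformSpace X)

open Filter Topology Set
open scoped Pointwise

/-! Write ψ for the golden conjugate, so |ψ| < 1 and ψ² = ψ + 1. Split the group into copies of ℤ² ≅
ℤ[ψ] and make the powers ψⁿ converge to 0 in each copy. A continuous character sends them to zₙ ∈ 𝕋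
with zₙ₊₂ = zₙ₊₁zₙ and zₙ → 1. Arguments of the tail satisfy a real Fibonacci recurrence and tend to
0, which excludes the expanding solution φⁿ; hence zₙ = exp(itψⁿ) for a real t
(`Circle.exists_eq_exp_mul_goldenConj_pow`). One real parameter per copy gives ℝ^ℕ.

The topology is coherent with the sets `goldenSums m` of m-fold sums of generators from the first m
copies; on each it is induced from ℝ^ℕ, where the image is compact. General facts on such
k_ω-topologies give the group operations, completeness and sequentiality. The compact-open topology
on the dual is that of ℝ^ℕ because compact sets involve finitely many coordinates, and because the
values on one sequence ψⁿ control |t| (`abs_lt_of_forall_abs_arg_exp_goldenConj`). -/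

/-- `A` is an increasing sequence of compact sets covering `X` that determines its topology. -/
structure IsKOmega {X : Type*} [TopologicalSpace X] (A : ℕ → Set X) : Prop where
  mono : Monotone A
  isCompact : ∀ n, IsCompact (A n)
  cover : ∀ x, ∃ n, x ∈ A n
  isOpen_of : ∀ U : Set X, (∀ n, ∀ x ∈ U, x ∈ A n → U ∈ 𝓝[A n] x) → IsOpen U

/-! ### Topologies determined by an increasing sequence of compact sets -/

namespace IsKOmega

variable {X Y : Type*} [TopologicalSpace X] [TopologicalSpace Y] {A : ℕ → Set X}

theorem continuous_of_continuousOn (hA : IsKOmega A) {g : X → Y}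
    (hg : ∀ n, ContinuousOn g (A n)) : Continuous g := by
  refine continuous_def.2 fun O hO => hA.isOpen_of _ fun n x hx hxn => ?_
  exact hg n x hxn (hO.mem_nhds hx)

/-- A relative neighbourhood of a compact set contains a compact one. -/
theorem exists_isCompact_between [T2Space X] {A K S : Set X} (hA : IsCompact A)
    (hK : IsCompact K) (hS : S ∈ 𝓝ˢ K) :
    ∃ K', IsCompact K' ∧ K' ⊆ A ∧ K' ⊆ S ∧ ∀ x ∈ K, K' ∈ 𝓝[A] x := by
  obtain ⟨O, hO, hKO, hOS⟩ := mem_nhdsSet_iff_exists.1 hS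
  obtain ⟨O₁, O₂, h₁, h₂, hK₁, hA₂, hd⟩ :=
    SeparatedNhds.of_isCompact_isCompact hK (hA.diff hO)
      (disjoint_left.2 fun x hx hx' => hx'.2 (hKO hx))
  refine ⟨A \ O₂, hA.diff h₂, sdiff_subset, fun x hx => hOS ?_, fun x hx => ?_⟩
  · by_contra hxO
    exact hx.2 (hA₂ ⟨hx.1, hxO⟩)
  · filter_upwards [self_mem_nhdsWithin, mem_nhdsWithin_of_mem_nhds (h₁.mem_nhds (hK₁ hx))]
      with y hy hy₁
    exact ⟨hy, fun hy₂ => disjoint_left.1 hd hy₁ hy₂⟩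

/-- Tube lemma for two compact sets, applied relative to `A` and followed by shrinking to compact
neighbourhoods so that it can be iterated. -/
theorem exists_compact_prod_step [T2Space X] {A K L : Set X} {W : Set (X × X)} (hA : IsCompact A)
    (hK : IsCompact K) (hL : IsCompact L)
    (hW : ∀ p ∈ K ×ˢ L, W ∈ 𝓝[A ×ˢ A] p) :
    ∃ K' L', IsCompact K' ∧ IsCompact L' ∧ K' ⊆ A ∧ L' ⊆ A ∧ K' ×ˢ L' ⊆ W ∧
      (∀ x ∈ K, K' ∈ 𝓝[A] x) ∧ ∀ x ∈ L, L' ∈ 𝓝[A] x := by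
  have h : W ∪ (A ×ˢ A)ᶜ ∈ 𝓝ˢ (K ×ˢ L) := by
    refine mem_nhdsSet_iff_forall.2 fun p hp => ?_
    have := mem_inf_principal.1 (hW p hp)
    filter_upwards [this] with q hq
    by_cases hqA : q ∈ A ×ˢ A
    · exact Or.inl (hq hqA)
    · exact Or.inr hqA
  rw [hK.nhdsSet_prod_eq hL] at h
  obtain ⟨S, hS, T, hT, hST⟩ := mem_prod_iff.1 h
  obtain ⟨K', hK', hKA, hKS, hKn⟩ := exists_isCompact_between hA hK hS
  obtain ⟨L', hL', hLA, hLT, hLn⟩ := exists_isCompact_between hA hL hT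
  refine ⟨K', L', hK', hL', hKA, hLA, fun p hp => ?_, hKn, hLn⟩
  rcases hST (mk_mem_prod (hKS hp.1) (hLT hp.2)) with h | h
  · exact h
  · exact absurd (mk_mem_prod (hKA hp.1) (hLA hp.2)) h

theorem isOpen_iUnion_of_succ (hA : IsKOmega A) (N : ℕ) {U : ℕ → Set X}
    (hUA : ∀ n, U n ⊆ A (N + n)) (hU : ∀ n, ∀ x ∈ U n, U (n + 1) ∈ 𝓝[A (N + (n + 1))] x) :
    IsOpen (⋃ n, U n) := by
  have hmono : Monotone U := monotone_nat_of_le_succ fun n x hx =>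
    mem_of_mem_nhdsWithin (hA.mono (by lia) (hUA n hx)) (hU n x hx)
  refine hA.isOpen_of _ fun n x hx _ => ?_
  obtain ⟨k, hk⟩ := mem_iUnion.1 hx
  have h := hU (max k n) x (hmono (le_max_left k n) hk)
  have hn : n ≤ N + (max k n + 1) := by lia
  exact mem_of_superset (nhdsWithin_mono x (hA.mono hn) h) (subset_iUnion U _)

/-- The square of a k_ω-space is again determined by the squares of its compact sets: a compact
rectangle inside `W` is thickened within each successive `A (N + n)`, and the two unions of sides
are open. This is what makes addition continuous. -/
theorem mem_nhds_prod [T2Space X] (hA : IsKOmega A) {W : Set (X × X)}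
    (hW : ∀ n, ∀ p ∈ W, p ∈ A n ×ˢ A n → W ∈ 𝓝[A n ×ˢ A n] p) {p : X × X} (hp : p ∈ W) :
    W ∈ 𝓝 p := by
  obtain ⟨x, y⟩ := p
  obtain ⟨N, hxN, hyN⟩ : ∃ N, x ∈ A N ∧ y ∈ A N := by
    obtain ⟨a, ha⟩ := hA.cover x
    obtain ⟨b, hb⟩ := hA.cover y
    exact ⟨max a b, hA.mono (le_max_left a b) ha, hA.mono (le_max_right a b) hb⟩
  let P : ℕ → Set X × Set X → Prop := fun n K =>
    IsCompact K.1 ∧ IsCompact K.2 ∧ K.1 ⊆ A (N + n) ∧ K.2 ⊆ A (N + n) ∧ K.1 ×ˢ K.2 ⊆ W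
  have hstep : ∀ n (K : {K // P n K}), ∃ K' : {K // P (n + 1) K},
      (∀ z ∈ K.1.1, K'.1.1 ∈ 𝓝[A (N + (n + 1))] z) ∧
        ∀ z ∈ K.1.2, K'.1.2 ∈ 𝓝[A (N + (n + 1))] z := by
    rintro n ⟨⟨K, L⟩, hK, hL, hKA, hLA, hKL⟩
    have hle : A (N + n) ⊆ A (N + (n + 1)) := hA.mono (by lia)
    obtain ⟨K', L', h₁, h₂, h₃, h₄, h₅, h₆, h₇⟩ :=
      exists_compact_prod_step (hA.isCompact (N + (n + 1))) hK hL
        fun q hq => hW _ q (hKL hq) ⟨hle (hKA hq.1), hle (hLA hq.2)⟩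
    exact ⟨⟨(K', L'), h₁, h₂, h₃, h₄, h₅⟩, h₆, h₇⟩
  choose next hnext₁ hnext₂ using hstep
  have h₀ : P 0 ({x}, {y}) := by
    refine ⟨isCompact_singleton, isCompact_singleton, by simpa using hxN, by simpa using hyN, ?_⟩
    rw [singleton_prod_singleton]
    simpa using hp
  let S : ∀ n, {K // P n K} := fun n => Nat.rec ⟨_, h₀⟩ next n
  have hSU : ∀ n, (S n).1.1 ⊆ A (N + n) := fun n => (S n).2.2.2.1
  have hSV : ∀ n, (S n).1.2 ⊆ A (N + n) := fun n => (S n).2.2.2.2.1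
  have hU := hA.isOpen_iUnion_of_succ N hSU fun n => hnext₁ n (S n)
  have hV := hA.isOpen_iUnion_of_succ N hSV fun n => hnext₂ n (S n)
  have hUm : Monotone fun n => (S n).1.1 := monotone_nat_of_le_succ fun n z hz =>
    mem_of_mem_nhdsWithin (hA.mono (by lia) (hSU n hz)) (hnext₁ n (S n) z hz)
  have hVm : Monotone fun n => (S n).1.2 := monotone_nat_of_le_succ fun n z hz =>
    mem_of_mem_nhdsWithin (hA.mono (by lia) (hSV n hz)) (hnext₂ n (S n) z hz)
  refine mem_of_superset (prod_mem_nhds (hU.mem_nhds (mem_iUnion.2 ⟨0, rfl⟩))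
    (hV.mem_nhds (mem_iUnion.2 ⟨0, rfl⟩))) ?_
  rintro ⟨a, b⟩ ⟨ha, hb⟩
  obtain ⟨i, hi⟩ := mem_iUnion.1 ha
  obtain ⟨j, hj⟩ := mem_iUnion.1 hb
  exact (S (max i j)).2.2.2.2.2 ⟨hUm (le_max_left i j) hi, hVm (le_max_right i j) hj⟩

theorem continuous_prod_of_continuousOn [T2Space X] (hA : IsKOmega A) {g : X × X → Y}
    (hg : ∀ n, ContinuousOn g (A n ×ˢ A n)) : Continuous g := by
  refine continuous_def.2 fun O hO => isOpen_iff_mem_nhds.2 fun p hp =>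
    hA.mem_nhds_prod (fun n q hq hqn => ?_) hp
  exact hg n q hqn (hO.mem_nhds hq)

theorem sequentialSpace (hA : IsKOmega A)
    (hc : ∀ n, ∀ x ∈ A n, (𝓝[A n] x).IsCountablyGenerated) : SequentialSpace X := by
  refine ⟨fun s hs => isOpen_compl_iff.1 (hA.isOpen_of _ fun n x hx hxn => ?_)⟩
  by_contra h
  have := hc n x hxn
  have hf : ∃ᶠ y in 𝓝[A n] x, y ∈ s := fun h' => h h'
  obtain ⟨y, hy, hys⟩ := exists_seq_forall_of_frequently hf
  exact hx (hs hys (tendsto_nhds_of_tendsto_nhdsWithin hy))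

/-- Choose `x n ∈ K` outside `A n`. Each `A m` contains `x k` only for `k < m`, so all tails of the
sequence are closed; their complements form a directed open cover of `K` without a member containing
`K`. -/
theorem exists_subset_of_isCompact [T1Space X] (hA : IsKOmega A) {K : Set X} (hK : IsCompact K) :
    ∃ n, K ⊆ A n := by
  by_contra! h
  choose x hxK hxA using fun n => not_subset.1 (h n)
  have hopen : ∀ n, IsOpen (x '' Ici n)ᶜ := by
    intro n
    refine hA.isOpen_of _ fun m z hz _ => ?_
    have hfin : (x '' Ico n m).Finite := (finite_Ico n m).image x
    have hz' : z ∉ x '' Ico n m := fun h => hz (image_mono Ico_subset_Ici_self h)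
    filter_upwards [self_mem_nhdsWithin,
      mem_nhdsWithin_of_mem_nhds (hfin.isClosed.isOpen_compl.mem_nhds hz')] with y hyA hy
    rintro ⟨k, hk, rfl⟩
    refine hy ⟨k, ⟨hk, ?_⟩, rfl⟩
    by_contra hkm
    exact hxA k (hA.mono (not_lt.1 hkm) hyA)
  obtain ⟨t, ht⟩ := hK.elim_directed_cover (fun n => (x '' Ici n)ᶜ) hopen
    (fun z _ => by
      obtain ⟨m, hm⟩ := hA.cover z
      refine mem_iUnion.2 ⟨m, ?_⟩
      rintro ⟨k, hk, rfl⟩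
      exact hxA k (hA.mono hk hm))
    (directed_of_isDirected_le fun m n hmn =>
      compl_subset_compl.2 (image_mono (Ici_subset_Ici.2 hmn)))
  exact ht (hxK t) ⟨t, self_mem_Ici, rfl⟩

/-- A Hausdorff group topology determined by a suitable sequence of compact sets is complete. -/
theorem isCompleteAddGroup {X : Type*} [AddCommGroup X] [TopologicalSpace X]
    [IsTopologicalAddGroup X] {A : ℕ → Set X} (hA : IsKOmega A)
    (hzero : ∀ n, 0 ∈ A n) (hadd : ∀ m n, ∀ x ∈ A m, ∀ y ∈ A n, x + y ∈ A (m + n)) :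
    IsCompleteAddGroup X := by
  let _ : UniformSpace X := IsTopologicalAddGroup.rightUniformSpace X
  refine ⟨fun {F} hF => ?_⟩
  have hF' : ∀ W ∈ 𝓝 (0 : X), ∃ t ∈ F, ∀ x ∈ t, ∀ y ∈ t, y - x ∈ W := by
    intro W hW
    obtain ⟨t, ht, htW⟩ := (cauchy_iff.1 hF).2 {p | p.2 - p.1 ∈ W}
      (by
        rw [uniformity_eq_comap_nhds_zero' X]
        simp only [sub_eq_add_neg]
        exact preimage_mem_comap hW)
    exact ⟨t, ht, fun x hx y hy => htW (mk_mem_prod hx hy)⟩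
  have := hF.1
  -- If `F` comes arbitrarily close to a single `A m`, its approximations inside `A m` have a
  -- cluster point by compactness, and `F` converges there.
  by_cases h : ∃ m, ∀ U ∈ 𝓝 (0 : X), ∀ t ∈ F, ∃ x ∈ t, ∃ a ∈ A m, x - a ∈ U
  · obtain ⟨m, hm⟩ := h
    let G : Filter X := ⨅ p : {p : Set X × Set X // p.1 ∈ 𝓝 (0 : X) ∧ p.2 ∈ F},
      𝓟 {a | a ∈ A m ∧ ∃ x ∈ p.1.2, x - a ∈ p.1.1}
    have hne : G.NeBot := by
      have : Nonempty {p : Set X × Set X // p.1 ∈ 𝓝 (0 : X) ∧ p.2 ∈ F} :=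
        ⟨⟨(univ, univ), univ_mem, univ_mem⟩⟩
      refine iInf_neBot_of_directed ?_ ?_
      · rintro ⟨⟨U, t⟩, hU, ht⟩ ⟨⟨U', t'⟩, hU', ht'⟩
        refine ⟨⟨(U ∩ U', t ∩ t'), inter_mem hU hU', inter_mem ht ht'⟩, ?_, ?_⟩
        · exact principal_mono.2 fun a ⟨ha, x, hx, hxa⟩ => ⟨ha, x, hx.1, hxa.1⟩
        · exact principal_mono.2 fun a ⟨ha, x, hx, hxa⟩ => ⟨ha, x, hx.2, hxa.2⟩
      · rintro ⟨⟨U, t⟩, hU, ht⟩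
        obtain ⟨x, hx, a, ha, hxa⟩ := hm U hU t ht
        exact principal_neBot_iff.2 ⟨a, ha, x, hx, hxa⟩
    obtain ⟨a, -, ha⟩ := (hA.isCompact m).exists_clusterPt (f := G) (iInf_le_of_le
      ⟨(univ, univ), univ_mem, univ_mem⟩ (principal_mono.2 fun a ha => ha.1))
    refine ⟨a, le_nhds_of_cauchy_adhp hF (clusterPt_iff_nonempty.2 ?_)⟩
    intro U hU t ht
    have h₁ : Tendsto (fun p : X × X => p.1 + p.2) (𝓝 a ×ˢ 𝓝 0) (𝓝 a) := by
      have : Tendsto (fun p : X × X => p.1 + p.2) (𝓝 (a, 0)) (𝓝 (a + 0)) :=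
        continuous_add.tendsto _
      rwa [add_zero, nhds_prod_eq] at this
    obtain ⟨V, hV, V', hV', hVU⟩ := mem_prod_iff.1 (h₁ hU)
    have h₂ : {a | a ∈ A m ∧ ∃ x ∈ t, x - a ∈ V'} ∈ G :=
      mem_iInf_of_mem ⟨(V', t), hV', ht⟩ (mem_principal_self _)
    obtain ⟨b, hbV, -, x, hxt, hxb⟩ := clusterPt_iff_nonempty.1 ha hV h₂
    refine ⟨x, ?_, hxt⟩
    have : b + (x - b) ∈ U := hVU (mk_mem_prod hbV hxb)
    rwa [add_sub_cancel] at this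
  · exfalso
    push Not at h
    choose U hU t ht hd using h
    -- Near a point of `A n` only the conditions with `m < n` matter, since `A n ⊆ A m` for the
    -- others. The index `m + m` is used because `x ∈ A k` and `y - x ∈ A k + U (k + k)` put `y` in
    -- `A (k + k) + U (k + k)`, which `t (k + k)` avoids.
    have hopen : IsOpen (⋂ m, {x | ∃ a ∈ A m, x - a ∈ interior (U (m + m))}) := by
      have h1 : ∀ m, IsOpen {x | ∃ a ∈ A m, x - a ∈ interior (U (m + m))} := by
        intro m
        have : {x | ∃ a ∈ A m, x - a ∈ interior (U (m + m))} =
            ⋃ a ∈ A m, (fun x => x - a) ⁻¹' interior (U (m + m)) := by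
          ext x; simp
        rw [this]
        exact isOpen_biUnion fun a _ => isOpen_interior.preimage (continuous_sub_right a)
      refine hA.isOpen_of _ fun n x hx hxn => ?_
      have h2 : (⋂ m ∈ Iio n, {x | ∃ a ∈ A m, x - a ∈ interior (U (m + m))}) ∈ 𝓝 x :=
        ((finite_Iio n).isOpen_biInter fun m _ => h1 m).mem_nhds
          (mem_iInter₂.2 fun m _ => mem_iInter.1 hx m)
      filter_upwards [self_mem_nhdsWithin, mem_nhdsWithin_of_mem_nhds h2] with y hy hy2
      refine mem_iInter.2 fun m => ?_
      rcases lt_or_ge m n with hmn | hmn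
      · exact mem_iInter₂.1 hy2 m hmn
      · refine ⟨y, hA.mono hmn hy, ?_⟩
        rw [sub_self]
        exact mem_interior_iff_mem_nhds.2 (hU _)
    obtain ⟨T, hT, hTW⟩ := hF' _ (hopen.mem_nhds (mem_iInter.2 fun m =>
      ⟨0, hzero m, by
        rw [sub_self]
        exact mem_interior_iff_mem_nhds.2 (hU _)⟩))
    obtain ⟨x, hx⟩ := Filter.nonempty_of_mem hT
    obtain ⟨k, hk⟩ := hA.cover x
    obtain ⟨y, hyT, hyt⟩ := Filter.nonempty_of_mem (inter_mem hT (ht (k + k)))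
    obtain ⟨a, ha, hya⟩ := mem_iInter.1 (hTW x hx y hyT) k
    refine hd (k + k) y hyt (x + a) (hadd _ _ x hk a ha) ?_
    rw [← sub_sub]
    exact interior_subset hya

end IsKOmega

/-! ### Coherent topologies induced piecewise by an injective map -/

/-- The topology on `X` whose open sets have on each `A n` an open trace, when `A n` carries the
topology induced by `f`. -/
@[reducible]
def coherentTopology {X H : Type*} [TopologicalSpace H] (f : X → H) (A : ℕ → Set X) :
    TopologicalSpace X where
  IsOpen U := ∀ n, ∀ x ∈ U, x ∈ A n → U ∈ comap f (𝓝 (f x)) ⊓ 𝓟 (A n)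
  isOpen_univ := fun _ _ _ _ => univ_mem
  isOpen_inter := fun _ _ hs ht n x hx hxn => inter_mem (hs n x hx.1 hxn) (ht n x hx.2 hxn)
  isOpen_sUnion := fun _ hS n x ⟨s, hs, hx⟩ hxn =>
    mem_of_superset (hS s hs n x hx hxn) (subset_sUnion_of_mem hs)

/-- The topology of `X` is `coherentTopology f A`, where the sets `A n` cover `X` and have compact
images under the injective map `f`. -/
structure IsCoherent {X H : Type*} [TopologicalSpace X] [TopologicalSpace H] (f : X → H)
    (A : ℕ → Set X) : Prop where
  isOpen_iff : ∀ U : Set X,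
    IsOpen U ↔ ∀ n, ∀ x ∈ U, x ∈ A n → U ∈ comap f (𝓝 (f x)) ⊓ 𝓟 (A n)
  injective : Function.Injective f
  mono : Monotone A
  cover : ∀ x, ∃ n, x ∈ A n
  isCompact_image : ∀ n, IsCompact (f '' A n)

namespace IsCoherent

section

variable {X H : Type*} [TopologicalSpace X] [TopologicalSpace H] {f : X → H} {A : ℕ → Set X}

theorem continuous (h : IsCoherent f A) : Continuous f := by
  refine continuous_def.2 fun O hO => (h.isOpen_iff _).2 fun n x hx _ => ?_
  exact mem_inf_of_left (preimage_mem_comap (hO.mem_nhds hx))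

theorem nhdsWithin_eq (h : IsCoherent f A) {n : ℕ} {x : X} (hx : x ∈ A n) :
    𝓝[A n] x = comap f (𝓝 (f x)) ⊓ 𝓟 (A n) := by
  refine le_antisymm (inf_le_inf_right _ h.continuous.continuousAt.le_comap) ?_
  refine le_inf (fun s hs => ?_) inf_le_right
  obtain ⟨U, hUs, hU, hxU⟩ := mem_nhds_iff.1 hs
  exact mem_of_superset ((h.isOpen_iff U).1 hU n x hxU hx) hUs

theorem tendsto_nhdsWithin_iff (h : IsCoherent f A) {n : ℕ} {x : X} (hx : x ∈ A n) {α : Type*}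
    {l : Filter α} {g : α → X} :
    Tendsto g l (𝓝[A n] x) ↔ Tendsto (f ∘ g) l (𝓝 (f x)) ∧ ∀ᶠ a in l, g a ∈ A n := by
  rw [h.nhdsWithin_eq hx, tendsto_inf, tendsto_comap_iff, tendsto_principal]

theorem t2Space [T2Space H] (h : IsCoherent f A) : T2Space X :=
  T2Space.of_injective_continuous h.injective h.continuous

theorem isKOmega (h : IsCoherent f A) : IsKOmega A where
  mono := h.mono
  cover := h.cover
  isOpen_of U hU := (h.isOpen_iff U).2 fun n x hx hxn => by
    rw [← h.nhdsWithin_eq hxn]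
    exact hU n x hx hxn
  isCompact n := by
    refine isCompact_iff_ultrafilter_le_nhds.2 fun u hu => ?_
    have h₁ : ↑(u.map f) ≤ 𝓟 (f '' A n) := by
      rw [Ultrafilter.coe_map, ← map_principal]
      exact map_mono hu
    obtain ⟨_, ⟨x, hx, rfl⟩, hux⟩ := isCompact_iff_ultrafilter_le_nhds.1 (h.isCompact_image n) _ h₁
    refine ⟨x, hx, le_trans ?_ (nhdsWithin_le_nhds (s := A n))⟩
    rw [h.nhdsWithin_eq hx]
    exact le_inf (map_le_iff_le_comap.1 hux) hu

theorem sequentialSpace [FirstCountableTopology H] (h : IsCoherent f A) : SequentialSpace X :=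
  h.isKOmega.sequentialSpace fun n x hx => by
    rw [h.nhdsWithin_eq hx]
    infer_instance

end

/-- Addition maps `A n ×ˢ A n` into `A (n + n)`, where convergence is tested in `H`. -/
theorem isTopologicalAddGroup {X H : Type*} [AddCommGroup X] [TopologicalSpace X]
    [AddCommGroup H] [TopologicalSpace H] [IsTopologicalAddGroup H] [T2Space H] {f : X →+ H}
    {A : ℕ → Set X} (h : IsCoherent f A)
    (hadd : ∀ m n, ∀ x ∈ A m, ∀ y ∈ A n, x + y ∈ A (m + n)) (hneg : ∀ n, ∀ x ∈ A n, -x ∈ A n) :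
    IsTopologicalAddGroup X where
  continuous_add := by
    have := h.t2Space
    refine h.isKOmega.continuous_prod_of_continuousOn fun n p hp => ?_
    refine ((h.tendsto_nhdsWithin_iff (hadd n n _ hp.1 _ hp.2)).2 ⟨?_, ?_⟩).mono_right
      nhdsWithin_le_nhds
    · have h₁ : Tendsto (fun q : X × X => f q.1 + f q.2) (𝓝[A n ×ˢ A n] p)
          (𝓝 (f p.1 + f p.2)) :=
        (((h.continuous.comp continuous_fst).add (h.continuous.comp continuous_snd)).tendsto
          p).mono_left nhdsWithin_le_nhds
      simpa [Function.comp_def] using h₁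
    · filter_upwards [self_mem_nhdsWithin] with q hq
      exact hadd n n _ hq.1 _ hq.2
  continuous_neg := by
    refine h.isKOmega.continuous_of_continuousOn fun n x hx => ?_
    refine ((h.tendsto_nhdsWithin_iff (hneg n x hx)).2 ⟨?_, ?_⟩).mono_right nhdsWithin_le_nhds
    · have h₁ : Tendsto (fun q : X => -f q) (𝓝[A n] x) (𝓝 (-f x)) :=
        (h.continuous.neg.tendsto x).mono_left nhdsWithin_le_nhds
      simpa [Function.comp_def] using h₁
    · filter_upwards [self_mem_nhdsWithin] with q hq
      exact hneg n q hq

end IsCoherent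

/-! ### Circle-valued Fibonacci sequences -/

theorem goldenConj_lt_neg_third : Real.goldenConj < -(1 / 3) := by
  have h := Real.goldenConj_sq
  have h₁ := Real.goldenConj_neg
  nlinarith

theorem tendsto_goldenConj_pow : Tendsto (fun n : ℕ => Real.goldenConj ^ n) atTop (𝓝 0) :=
  tendsto_pow_atTop_nhds_zero_of_abs_lt_one
    (abs_lt.2 ⟨Real.neg_one_lt_goldenConj, Real.goldenConj_neg.trans one_pos⟩)

/-- The number `s` and the argument differ by a multiple of 2π of absolute value less than 3π/2 +
π/2 = 2π. -/
theorem Circle.abs_lt_pi_div_two_of_abs_arg_exp {s : ℝ} (hs : |s| < 3 * (Real.pi / 2))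
    (h : |Complex.arg (Circle.exp s)| < Real.pi / 2) : |s| < Real.pi / 2 := by
  obtain ⟨m, hm⟩ := Circle.exp_eq_exp.1 (Circle.exp_arg (Circle.exp s))
  have hπ := Real.pi_pos
  rw [abs_lt] at hs h
  have h1 : (m : ℝ) < 1 := by nlinarith
  have h2 : (-1 : ℝ) < m := by nlinarith
  have hm0 : m = 0 := by
    have h1' : m < 1 := by exact_mod_cast h1
    have h2' : -1 < m := by exact_mod_cast h2
    lia
  rw [hm0, Int.cast_zero, zero_mul, add_zero] at hm
  rw [abs_lt]
  constructor <;> linarith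

/-- The bound holds for `t * ψ ^ n` with `n` large and descends to `n = 0`: since |ψ| > 1/3, each
step back gives at most the bound 3π/2, which the hypothesis improves to π/2. -/
theorem abs_lt_of_forall_abs_arg_exp_goldenConj {t : ℝ}
    (h : ∀ n : ℕ, |Complex.arg (Circle.exp (t * Real.goldenConj ^ n))| < Real.pi / 2) :
    |t| < Real.pi / 2 := by
  have hπ := Real.pi_pos
  have hdesc : ∀ n : ℕ, |t * Real.goldenConj ^ n| < Real.pi / 2 → |t| < Real.pi / 2 := by
    intro n
    induction n with
    | zero => simp
    | succ n ih =>
      intro hn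
      refine ih (Circle.abs_lt_pi_div_two_of_abs_arg_exp ?_ (h n))
      rw [pow_succ, ← mul_assoc, abs_mul, abs_of_neg Real.goldenConj_neg] at hn
      have h0 := abs_nonneg (t * Real.goldenConj ^ n)
      nlinarith [goldenConj_lt_neg_third]
  have hlim : Tendsto (fun n : ℕ => |t * Real.goldenConj ^ n|) atTop (𝓝 0) := by
    simpa using (tendsto_goldenConj_pow.const_mul t).abs
  obtain ⟨n, hn⟩ := (hlim.eventually (gt_mem_nhds (half_pos hπ))).exists
  exact hdesc n hn

/-- The combination `a (n + 1) - ψ * a n` is geometric with ratio φ > 1, so it can tend to 0 only if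
it vanishes. -/
theorem eq_mul_goldenConj_pow {a : ℕ → ℝ} (hrec : ∀ n, a (n + 2) = a (n + 1) + a n)
    (hlim : Tendsto a atTop (𝓝 0)) (n : ℕ) : a n = a 0 * Real.goldenConj ^ n := by
  have hb : ∀ n, a (n + 1) - Real.goldenConj * a n =
      (a 1 - Real.goldenConj * a 0) * Real.goldenRatio ^ n := by
    intro n
    induction n with
    | zero => simp
    | succ n ih =>
      rw [pow_succ, ← mul_assoc, ← ih, hrec]
      linear_combination (-(a (n + 1))) * Real.goldenRatio_add_goldenConj +
        a n * Real.goldenRatio_mul_goldenConj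
  have hlim' : Tendsto (fun n => a (n + 1) - Real.goldenConj * a n) atTop (𝓝 0) := by
    simpa using (hlim.comp (tendsto_add_atTop_nat 1)).sub (hlim.const_mul Real.goldenConj)
  have h0 : a 1 - Real.goldenConj * a 0 = 0 := by
    have habs : Tendsto (fun n => |a (n + 1) - Real.goldenConj * a n|) atTop (𝓝 0) := by
      simpa using hlim'.abs
    refine abs_nonpos_iff.1 (ge_of_tendsto' habs fun n => ?_)
    rw [hb n, abs_mul]
    refine le_mul_of_one_le_right (abs_nonneg _) ?_
    rw [abs_of_pos (pow_pos Real.goldenRatio_pos n)]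
    exact one_le_pow₀ Real.one_lt_goldenRatio.le
  induction n with
  | zero => simp
  | succ n ih =>
    have := hb n
    rw [h0, zero_mul] at this
    rw [pow_succ]
    linear_combination this + Real.goldenConj * ih

theorem Circle.exists_eq_exp_mul_goldenConj_pow {z : ℕ → Circle}
    (hrec : ∀ n, z (n + 2) = z (n + 1) * z n) (hlim : Tendsto z atTop (𝓝 1)) :
    ∃ t : ℝ, ∀ n, z n = Circle.exp (t * Real.goldenConj ^ n) := by
  have hπ := Real.pi_gt_three
  have harg : Tendsto (fun n => Complex.arg (z n)) atTop (𝓝 0) := by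
    have h1 : ContinuousAt (fun w : Circle => Complex.arg w) 1 :=
      (Complex.continuousAt_arg (by simp)).comp continuous_subtype_val.continuousAt
    have := h1.tendsto.comp hlim
    simpa [Function.comp_def] using this
  obtain ⟨N, hN⟩ := eventually_atTop.1
    (harg.eventually (Metric.ball_mem_nhds (0 : ℝ) one_pos))
  -- Two arguments below 1 add up to less than π, so the recurrence lifts from the circle to ℝ.
  have hN' : ∀ n ≥ N, |Complex.arg (z n)| < 1 := fun n hn => by simpa using hN n hn
  have hrec' : ∀ n, Complex.arg (z (N + (n + 2))) =
      Complex.arg (z (N + (n + 1))) + Complex.arg (z (N + n)) := by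
    intro n
    have h0 := abs_lt.1 (hN' (N + n) (by lia))
    have h1 := abs_lt.1 (hN' (N + (n + 1)) (by lia))
    have : z (N + (n + 2)) =
        Circle.exp (Complex.arg (z (N + (n + 1))) + Complex.arg (z (N + n))) := by
      rw [Circle.exp_add, Circle.exp_arg, Circle.exp_arg]
      exact hrec (N + n)
    rw [this, Circle.arg_exp] <;> linarith
  have ha := eq_mul_goldenConj_pow (a := fun n => Complex.arg (z (N + n))) hrec'
    (harg.comp (tendsto_add_atTop_nat N |>.congr fun n => add_comm n N))
  let t : ℝ := Complex.arg (z N) / Real.goldenConj ^ N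
  have hψ := Real.goldenConj_ne_zero
  have hlarge : ∀ n, z (N + n) = Circle.exp (t * Real.goldenConj ^ (N + n)) := by
    intro n
    rw [← Circle.exp_arg (z (N + n)), show Complex.arg (z (N + n)) = _ from ha n]
    congr 1
    simp only [t, add_zero]
    field_simp
    ring
  refine ⟨t, ?_⟩
  -- The formula extends below `N` because the recurrence can be solved for its earliest term.
  have hdesc : ∀ k n, N ≤ n + k → z n = Circle.exp (t * Real.goldenConj ^ n) := by
    intro k
    induction k with
    | zero =>
      intro n hn
      obtain ⟨m, rfl⟩ := Nat.exists_eq_add_of_le hn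
      exact hlarge m
    | succ k ih =>
      intro n hn
      have h1 := ih (n + 1) (by lia)
      have h2 := ih (n + 2) (by lia)
      rw [hrec, h1] at h2
      rw [eq_inv_mul_of_mul_eq h2, ← Circle.exp_neg, ← Circle.exp_add]
      congr 1
      linear_combination t * Real.goldenConj ^ n * Real.goldenConj_sq
  exact fun n => hdesc N n (by lia)

theorem IsCompact.nsmul_set {M : Type*} [TopologicalSpace M] [AddMonoid M] [ContinuousAdd M]
    {K : Set M} (hK : IsCompact K) (n : ℕ) : IsCompact (n • K) := by
  induction n with
  | zero => rw [zero_nsmul]; exact isCompact_singleton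
  | succ n ih => rw [succ_nsmul]; exact ih.add hK

theorem Circle.eq_zero_of_exp_eq_one {s : ℝ} (hs : |s| < Real.pi / 2) (h : Circle.exp s = 1) :
    s = 0 := by
  have hπ := Real.pi_pos
  rw [abs_lt] at hs
  rw [← Circle.arg_exp (x := s) (by linarith) (by linarith), h]
  simp

/-! ### The sequences representing ψⁿ and the pairing with real sequences -/

/-- The elements of the `j`-th copy of `ℤ²` that represent the powers of the golden conjugate. -/
noncomputable def goldenSeq (j n : ℕ) : ℕ →₀ ℤ :=
  -- These are the coefficients in ψⁿ = Fₙ₋₁ + Fₙψ; the difference stands for Fₙ₋₁ and has the right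
  -- value 1 at `n = 0`.
  Finsupp.single (2 * j) ((n + 1).fib - n.fib : ℤ) + Finsupp.single (2 * j + 1) (n.fib : ℤ)

theorem goldenSeq_zero (j : ℕ) : goldenSeq j 0 = Finsupp.single (2 * j) 1 := by
  simp [goldenSeq]

theorem goldenSeq_one (j : ℕ) : goldenSeq j 1 = Finsupp.single (2 * j + 1) 1 := by
  simp [goldenSeq]

theorem goldenSeq_add_two (j n : ℕ) :
    goldenSeq j (n + 2) = goldenSeq j (n + 1) + goldenSeq j n := by
  have h := Nat.fib_add_two (n := n)
  have h' := Nat.fib_add_two (n := n + 1)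
  simp only [goldenSeq, h, h', add_assoc, Nat.reduceAdd] at *
  ext i
  simp only [Finsupp.add_apply, Finsupp.single_apply]
  push_cast
  split_ifs <;> ring

theorem goldenSeq_induction {p : (ℕ →₀ ℤ) → Prop} (zero : p 0) (add : ∀ x y, p x → p y → p (x + y))
    (neg : ∀ x, p x → p (-x)) (mem : ∀ j n, p (goldenSeq j n)) (x : ℕ →₀ ℤ) : p x := by
  let S : AddSubgroup (ℕ →₀ ℤ) :=
    { carrier := {x | p x}
      zero_mem' := zero
      add_mem' := fun {x y} hx hy => add x y hx hy
      neg_mem' := fun {x} hx => neg x hx }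
  change x ∈ S
  induction x using Finsupp.induction_linear with
  | zero => exact S.zero_mem
  | add x y hx hy => exact S.add_mem hx hy
  | single i a =>
    have h1 : Finsupp.single i (1 : ℤ) ∈ S := by
      rcases Nat.even_or_odd' i with ⟨j, rfl | rfl⟩
      · rw [← goldenSeq_zero]
        exact mem j 0
      · rw [← goldenSeq_one]
        exact mem j 1
    have h2 := S.zsmul_mem h1 a
    rwa [Finsupp.smul_single, smul_eq_mul, mul_one] at h2

/-- The pairing of `ℕ →₀ ℤ` with real sequences for which `goldenSeq j n` and `t` give
`t j * ψ ^ n`. -/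
noncomputable def goldenPairing (t : ℕ → ℝ) : (ℕ →₀ ℤ) →+ ℝ :=
  (Finsupp.linearCombination ℤ fun i => t (i / 2) * Real.goldenConj ^ (i % 2)).toAddMonoidHom

theorem goldenPairing_goldenSeq (t : ℕ → ℝ) (j n : ℕ) :
    goldenPairing t (goldenSeq j n) = t j * Real.goldenConj ^ n := by
  induction n using Nat.twoStepInduction with
  | zero => simp [goldenPairing, goldenSeq_zero]
  | one =>
    have h : (2 * j + 1) / 2 = j := by lia
    simp [goldenPairing, goldenSeq_one, h]
  | more n h0 h1 =>
    rw [goldenSeq_add_two, map_add, h0, h1]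
    linear_combination (-(t j * Real.goldenConj ^ n)) * Real.goldenConj_sq

theorem goldenPairing_add (s t : ℕ → ℝ) (x : ℕ →₀ ℤ) :
    goldenPairing (s + t) x = goldenPairing s x + goldenPairing t x := by
  induction x using goldenSeq_induction with
  | zero => simp
  | add x y hx hy => simp only [map_add, hx, hy]; ring
  | neg x hx => simp only [map_neg, hx]; ring
  | mem j n => simp only [goldenPairing_goldenSeq, Pi.add_apply]; ring

/-- The embedding of `ℕ →₀ ℤ` into `ℝ^ℕ` that sends `goldenSeq j n` to `ψ ^ n` in the `j`-th
coordinate. -/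
noncomputable def goldenEmbedding : (ℕ →₀ ℤ) →+ (ℕ → ℝ) :=
  AddMonoidHom.mk' (fun x j => goldenPairing (Pi.single j 1) x) fun x y => by
    ext j
    simp

theorem goldenEmbedding_apply (x : ℕ →₀ ℤ) (j : ℕ) :
    goldenEmbedding x j = goldenPairing (Pi.single j 1) x := rfl

theorem goldenEmbedding_goldenSeq (j n : ℕ) :
    goldenEmbedding (goldenSeq j n) = Pi.single j (Real.goldenConj ^ n) := by
  ext i
  rw [goldenEmbedding_apply, goldenPairing_goldenSeq]
  rcases eq_or_ne i j with rfl | h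
  · simp
  · simp [h.symm, h]

theorem goldenPairing_single (x : ℕ →₀ ℤ) (j : ℕ) (s : ℝ) :
    goldenPairing (Pi.single j s) x = s * goldenEmbedding x j := by
  rw [goldenEmbedding_apply]
  induction x using goldenSeq_induction with
  | zero => simp
  | add x y hx hy => simp only [map_add, hx, hy]; ring
  | neg x hx => simp only [map_neg, hx]; ring
  | mem i n =>
    simp only [goldenPairing_goldenSeq]
    rcases eq_or_ne i j with rfl | h
    · simp
    · simp [h]

theorem goldenEmbedding_eq (x : ℕ →₀ ℤ) (j : ℕ) :
    goldenEmbedding x j = x (2 * j) + x (2 * j + 1) * Real.goldenConj := by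
  induction x using Finsupp.induction_linear with
  | zero => simp
  | add x y hx hy => simp only [map_add, Pi.add_apply, Finsupp.add_apply, hx, hy]; push_cast; ring
  | single i a =>
    have h : Finsupp.single i a = a • Finsupp.single i 1 := by simp
    rw [h, map_zsmul]
    rcases Nat.even_or_odd' i with ⟨k, rfl | rfl⟩
    · rw [← goldenSeq_zero, goldenEmbedding_goldenSeq, goldenSeq_zero]
      rcases eq_or_ne k j with rfl | hk
      · simp
      · have : 2 * k ≠ 2 * j + 1 := by lia
        simp [hk.symm, this]
    · rw [← goldenSeq_one, goldenEmbedding_goldenSeq, goldenSeq_one]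
      rcases eq_or_ne k j with rfl | hk
      · simp
      · have : 2 * k + 1 ≠ 2 * j := by lia
        simp [hk.symm, this]

/-- By irrationality of ψ, 1 and ψ are independent over ℤ. -/
theorem goldenEmbedding_injective : Function.Injective goldenEmbedding := by
  refine (injective_iff_map_eq_zero _).2 fun x hx => ?_
  have h : ∀ j, x (2 * j) = 0 ∧ x (2 * j + 1) = 0 := by
    intro j
    have hj : (x (2 * j) : ℝ) + x (2 * j + 1) * Real.goldenConj = 0 := by
      rw [← goldenEmbedding_eq, hx]
      rfl
    have h1 : x (2 * j + 1) = 0 := by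
      by_contra hne
      refine (Real.goldenConj_irrational.intCast_mul hne).intCast_add (x (2 * j)) ⟨0, ?_⟩
      rw [hj, Rat.cast_zero]
    rw [h1] at hj
    refine ⟨by simpa using hj, h1⟩
  ext i
  rcases Nat.even_or_odd' i with ⟨j, rfl | rfl⟩
  · exact (h j).1
  · exact (h j).2

/-! ### The compact sets that determine the topology -/

/-- The terms of the first `m` sequences `goldenSeq j`, zero, and their negatives. -/
def goldenGenerators (m : ℕ) : Set (ℕ →₀ ℤ) :=
  {0} ∪ ⋃ j ∈ Iio m, (insert 0 (range (goldenSeq j)) ∪ -insert 0 (range (goldenSeq j)))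

/-- The sums of at most `m` elements of `goldenGenerators m`. -/
def goldenSums (m : ℕ) : Set (ℕ →₀ ℤ) := m • goldenGenerators m

theorem zero_mem_goldenGenerators (m : ℕ) : 0 ∈ goldenGenerators m := Or.inl rfl

theorem goldenGenerators_mono : Monotone goldenGenerators := fun _ _ h =>
  union_subset_union_right _ (biUnion_subset_biUnion_left (Iio_subset_Iio h))

theorem goldenSeq_mem_goldenGenerators {j m : ℕ} (h : j < m) (n : ℕ) :
    goldenSeq j n ∈ goldenGenerators m :=
  Or.inr (mem_biUnion (mem_Iio.2 h) (Or.inl (Or.inr ⟨n, rfl⟩)))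

theorem neg_mem_goldenGenerators {m : ℕ} {x : ℕ →₀ ℤ} (hx : x ∈ goldenGenerators m) :
    -x ∈ goldenGenerators m := by
  rcases hx with rfl | hx
  · rw [neg_zero]
    exact zero_mem_goldenGenerators m
  · obtain ⟨j, hj, hx | hx⟩ := mem_iUnion₂.1 hx
    · exact Or.inr (mem_biUnion hj (Or.inr (by simpa using hx)))
    · exact Or.inr (mem_biUnion hj (Or.inl hx))

theorem zero_mem_goldenSums (m : ℕ) : 0 ∈ goldenSums m := by
  have := Set.nsmul_mem_nsmul (n := m) (zero_mem_goldenGenerators m)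
  rwa [nsmul_zero] at this

theorem goldenSums_mono : Monotone goldenSums := fun _ n h =>
  Set.nsmul_subset_nsmul (goldenGenerators_mono h) (zero_mem_goldenGenerators n) h

theorem add_mem_goldenSums (m n : ℕ) (x : ℕ →₀ ℤ) (hx : x ∈ goldenSums m) (y : ℕ →₀ ℤ)
    (hy : y ∈ goldenSums n) : x + y ∈ goldenSums (m + n) := by
  have h1 := Set.nsmul_subset_nsmul (goldenGenerators_mono (Nat.le_add_right m n))
    (zero_mem_goldenGenerators _) le_rfl hx
  have h2 := Set.nsmul_subset_nsmul (goldenGenerators_mono (Nat.le_add_left n m))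
    (zero_mem_goldenGenerators _) le_rfl hy
  rw [goldenSums, add_nsmul]
  exact Set.add_mem_add h1 h2

theorem neg_mem_goldenSums (m : ℕ) (x : ℕ →₀ ℤ) (hx : x ∈ goldenSums m) :
    -x ∈ goldenSums m := by
  have h : -goldenSums m ⊆ goldenSums m := by
    rw [goldenSums, ← neg_nsmul]
    refine Set.nsmul_subset_nsmul (fun y hy => ?_) (zero_mem_goldenGenerators _) le_rfl
    simpa using neg_mem_goldenGenerators hy
  exact h (by simpa using hx)

theorem goldenSeq_mem_goldenSums {j m : ℕ} (h : j < m) (n : ℕ) :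
    goldenSeq j n ∈ goldenSums m := by
  have := Set.nsmul_subset_nsmul (m := 1) subset_rfl (zero_mem_goldenGenerators m)
    (show 1 ≤ m by lia)
  rw [one_nsmul] at this
  exact this (goldenSeq_mem_goldenGenerators h n)

theorem exists_mem_goldenSums (x : ℕ →₀ ℤ) : ∃ m, x ∈ goldenSums m := by
  induction x using goldenSeq_induction with
  | zero => exact ⟨0, zero_mem_goldenSums 0⟩
  | add x y hx hy =>
    obtain ⟨m, hm⟩ := hx
    obtain ⟨n, hn⟩ := hy
    exact ⟨m + n, add_mem_goldenSums m n x hm y hn⟩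
  | neg x hx =>
    obtain ⟨m, hm⟩ := hx
    exact ⟨m, neg_mem_goldenSums m x hm⟩
  | mem j n => exact ⟨j + 1, goldenSeq_mem_goldenSums j.lt_succ_self n⟩

theorem goldenSums_subset {m : ℕ} {S : AddSubgroup (ℕ →₀ ℤ)}
    (hS : ∀ j < m, ∀ n, goldenSeq j n ∈ S) : goldenSums m ⊆ S := by
  have h0 : ∀ j < m, insert 0 (range (goldenSeq j)) ⊆ (S : Set (ℕ →₀ ℤ)) := fun j hj =>
    insert_subset S.zero_mem (range_subset_iff.2 (hS j hj))
  have hgen : goldenGenerators m ⊆ S := by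
    refine union_subset (singleton_subset_iff.2 S.zero_mem) (iUnion₂_subset fun j hj =>
      union_subset (h0 j hj) fun x hx => ?_)
    exact S.neg_mem_iff.1 (h0 j hj hx)
  have h : ∀ k : ℕ, k • goldenGenerators m ⊆ S := by
    intro k
    induction k with
    | zero => rw [zero_nsmul]; exact singleton_subset_iff.2 S.zero_mem
    | succ k ih =>
      rw [succ_nsmul]
      rintro _ ⟨x, hx, y, hy, rfl⟩
      exact S.add_mem (ih hx) (hgen hy)
  exact h m

/-- This makes the pairing continuous on each `goldenSums m` for every `t`, with no decay condition.
-/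
theorem goldenPairing_eq_sum (t : ℕ → ℝ) {m : ℕ} {x : ℕ →₀ ℤ} (hx : x ∈ goldenSums m) :
    goldenPairing t x = ∑ j ∈ Finset.range m, t j * goldenEmbedding x j := by
  let g : (ℕ →₀ ℤ) →+ ℝ := AddMonoidHom.mk'
    (fun x => ∑ j ∈ Finset.range m, t j * goldenEmbedding x j) fun x y => by
      simp [mul_add, Finset.sum_add_distrib]
  refine goldenSums_subset (S := (goldenPairing t).eqLocus g) (fun j hj n => ?_) hx
  change goldenPairing t (goldenSeq j n) =
    ∑ i ∈ Finset.range m, t i * goldenEmbedding (goldenSeq j n) i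
  rw [goldenPairing_goldenSeq, goldenEmbedding_goldenSeq, Finset.sum_eq_single j]
  · simp
  · intro i _ hi
    simp [hi]
  · intro h
    exact absurd (Finset.mem_range.2 hj) h

theorem tendsto_goldenEmbedding_goldenSeq (j : ℕ) :
    Tendsto (fun n => goldenEmbedding (goldenSeq j n)) atTop (𝓝 0) := by
  have h := ((continuous_single (A := fun _ : ℕ => ℝ) j).tendsto 0).comp tendsto_goldenConj_pow
  simpa [goldenEmbedding_goldenSeq, Function.comp_def] using h

theorem isCompact_goldenEmbedding_image (m : ℕ) : IsCompact (goldenEmbedding '' goldenSums m) := by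
  rw [goldenSums, image_nsmul]
  refine IsCompact.nsmul_set ?_ m
  have h : ∀ j, IsCompact (goldenEmbedding '' insert 0 (range (goldenSeq j))) := fun j => by
    rw [image_insert_eq, map_zero, ← range_comp]
    exact (tendsto_goldenEmbedding_goldenSeq j).isCompact_insert_range
  rw [goldenGenerators, image_union, image_iUnion₂]
  refine IsCompact.union (by simp) ((finite_Iio m).isCompact_biUnion fun j _ => ?_)
  rw [image_union, image_neg]
  exact (h j).union (h j).neg

theorem isCoherent_goldenEmbedding :
    @IsCoherent _ _ (coherentTopology goldenEmbedding goldenSums) _ goldenEmbedding goldenSums :=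
  let _ := coherentTopology goldenEmbedding goldenSums
  { isOpen_iff := fun _ => Iff.rfl
    injective := goldenEmbedding_injective
    mono := goldenSums_mono
    cover := exists_mem_goldenSums
    isCompact_image := isCompact_goldenEmbedding_image }

/-! ### The dual group -/

namespace IsCoherent

variable [TopologicalSpace (ℕ →₀ ℤ)]

theorem tendsto_goldenSeq (h : IsCoherent goldenEmbedding goldenSums) (j : ℕ) :
    Tendsto (goldenSeq j) atTop (𝓝 0) := by
  refine tendsto_nhds_of_tendsto_nhdsWithin (s := goldenSums (j + 1))
    ((h.tendsto_nhdsWithin_iff (zero_mem_goldenSums _)).2 ⟨?_, ?_⟩)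
  · rw [map_zero]
    exact tendsto_goldenEmbedding_goldenSeq j
  · exact Eventually.of_forall fun n => goldenSeq_mem_goldenSums j.lt_succ_self n

theorem continuous_goldenPairing (h : IsCoherent goldenEmbedding goldenSums) (t : ℕ → ℝ) :
    Continuous (goldenPairing t) := by
  refine h.isKOmega.continuous_of_continuousOn fun m => ?_
  have hc : Continuous fun x => ∑ j ∈ Finset.range m, t j * goldenEmbedding x j :=
    continuous_finsetSum _ fun j _ =>
      continuous_const.mul ((continuous_apply j).comp h.continuous)
  exact hc.continuousOn.congr fun x hx => goldenPairing_eq_sum t hx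

/-- The characters `x ↦ exp (i ⟨t, x⟩)`. -/
noncomputable def character (h : IsCoherent goldenEmbedding goldenSums) :
    Multiplicative (ℕ → ℝ) →* DualGroup (ℕ →₀ ℤ) where
  toFun t :=
    (⟨⟨⟨fun x => Circle.exp (goldenPairing t.toAdd x.toAdd), by simp⟩, fun x y => by simp⟩,
      Circle.exp.continuous.comp (h.continuous_goldenPairing t.toAdd)⟩ :
      Multiplicative (ℕ →₀ ℤ) →ₜ* Circle)
  map_one' := by
    refine PontryaginDual.ext fun x => ?_
    change Circle.exp (goldenPairing 0 x.toAdd) = 1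
    have h0 := goldenPairing_add 0 0 x.toAdd
    rw [add_zero, left_eq_add] at h0
    rw [h0, Circle.exp_zero]
  map_mul' s t := by
    refine PontryaginDual.ext fun x => ?_
    change Circle.exp (goldenPairing (s.toAdd + t.toAdd) x.toAdd) =
      Circle.exp (goldenPairing s.toAdd x.toAdd) * Circle.exp (goldenPairing t.toAdd x.toAdd)
    rw [goldenPairing_add, Circle.exp_add]

theorem character_apply (h : IsCoherent goldenEmbedding goldenSums) (t : Multiplicative (ℕ → ℝ))
    (x : ℕ →₀ ℤ) :
    h.character t (Multiplicative.ofAdd x) = Circle.exp (goldenPairing t.toAdd x) := rfl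

theorem isMAP (h : IsCoherent goldenEmbedding goldenSums) : IsMAP (ℕ →₀ ℤ) := by
  refine Subset.antisymm (fun x hx => ?_) (singleton_subset_iff.2 (mem_iInter.2 fun χ => ?_))
  · refine goldenEmbedding_injective ?_
    rw [map_zero]
    ext j
    by_contra hne
    -- The parameter is chosen so that `x` pairs to π and the character takes the value -1.
    have hx' := mem_iInter.1 hx (h.character (Multiplicative.ofAdd
      (Pi.single j (Real.pi / goldenEmbedding x j))))
    rw [mem_ofPred_eq, character_apply, toAdd_ofAdd, goldenPairing_single,
      div_mul_cancel₀ _ hne] at hx'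
    have := congrArg (Subtype.val : Circle → ℂ) hx'
    norm_num at this
  · exact map_one χ

theorem character_injective (h : IsCoherent goldenEmbedding goldenSums) :
    Function.Injective h.character := by
  refine (injective_iff_map_eq_one _).2 fun t ht => ?_
  have hj : ∀ j n, Circle.exp (t.toAdd j * Real.goldenConj ^ n) = 1 := fun j n => by
    rw [← goldenPairing_goldenSeq, ← h.character_apply, ht]
    rfl
  refine Multiplicative.toAdd.injective (funext fun j => ?_)
  refine Circle.eq_zero_of_exp_eq_one (abs_lt_of_forall_abs_arg_exp_goldenConj fun n => ?_) ?_
  · rw [hj]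
    simp [Real.pi_pos]
  · simpa using hj j 0

theorem character_surjective (h : IsCoherent goldenEmbedding goldenSums) :
    Function.Surjective h.character := by
  intro χ
  have hχ : Continuous fun x : ℕ →₀ ℤ => χ (Multiplicative.ofAdd x) := map_continuous χ
  have hex : ∀ j, ∃ t : ℝ, ∀ n, χ (Multiplicative.ofAdd (goldenSeq j n)) =
      Circle.exp (t * Real.goldenConj ^ n) := by
    intro j
    refine Circle.exists_eq_exp_mul_goldenConj_pow (fun n => ?_) ?_
    · rw [goldenSeq_add_two, ofAdd_add, map_mul]
    · have := (hχ.tendsto 0).comp (h.tendsto_goldenSeq j)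
      rwa [ofAdd_zero, map_one] at this
  choose t ht using hex
  refine ⟨Multiplicative.ofAdd t, PontryaginDual.ext fun x => ?_⟩
  obtain ⟨x, rfl⟩ := Multiplicative.ofAdd.surjective x
  rw [character_apply, toAdd_ofAdd]
  induction x using goldenSeq_induction with
  | zero => simp
  | add x y hx hy => rw [map_add, Circle.exp_add, ofAdd_add, map_mul, hx, hy]
  | neg x hx => rw [map_neg, Circle.exp_neg, ofAdd_neg, map_inv, hx]
  | mem j n => rw [goldenPairing_goldenSeq, ht]

/-- A compact set lies in some `goldenSums m`, where the character is given by a finite sum, jointly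
continuous in parameter and point; currying gives continuity into the compact-open topology. -/
theorem continuous_character (h : IsCoherent goldenEmbedding goldenSums) :
    Continuous h.character := by
  have := h.t2Space
  refine continuous_induced_rng.2 (ContinuousMap.continuous_compactOpen.2 fun K hK U hU => ?_)
  obtain ⟨m, hm⟩ := h.isKOmega.exists_subset_of_isCompact (K := Multiplicative.ofAdd ⁻¹' K) hK
  have hc : Continuous fun p : Multiplicative (ℕ → ℝ) × Multiplicative (ℕ →₀ ℤ) =>
      Circle.exp (∑ j ∈ Finset.range m, p.1.toAdd j * goldenEmbedding p.2.toAdd j) := by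
    refine Circle.exp.continuous.comp (continuous_finsetSum _ fun j _ => ?_)
    exact ((continuous_apply j).comp (continuous_toAdd.comp continuous_fst)).mul
      ((continuous_apply j).comp (h.continuous.comp (continuous_toAdd.comp continuous_snd)))
  let g : Multiplicative (ℕ → ℝ) → C(Multiplicative (ℕ →₀ ℤ), Circle) := fun t =>
    ⟨fun x => Circle.exp (∑ j ∈ Finset.range m, t.toAdd j * goldenEmbedding x.toAdd j),
      hc.comp (Continuous.prodMk_right t)⟩
  have hg : Continuous g := ContinuousMap.continuous_of_continuous_uncurry g hc
  convert ContinuousMap.continuous_compactOpen.1 hg K hK U hU using 3 with t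
  refine forall₂_congr fun x hx => ?_
  change Circle.exp (goldenPairing t.toAdd x.toAdd) ∈ U ↔ _
  rw [goldenPairing_eq_sum t.toAdd (x := x.toAdd) (hm hx)]
  rfl

/-- The dual group of `ℕ →₀ ℤ` is `ℝ^ℕ`. -/
noncomputable def dualEquiv (h : IsCoherent goldenEmbedding goldenSums) :
    Multiplicative (ℕ → ℝ) ≃* DualGroup (ℕ →₀ ℤ) :=
  MulEquiv.ofBijective h.character ⟨h.character_injective, h.character_surjective⟩

theorem continuous_dualEquiv_symm (h : IsCoherent goldenEmbedding goldenSums) :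
    Continuous h.dualEquiv.symm := by
  have hπ := Real.pi_pos
  refine continuous_of_continuousAt_one h.dualEquiv.symm ?_
  have hind : Continuous fun χ : DualGroup (ℕ →₀ ℤ) =>
      @ContinuousMonoidHom.toContinuousMap (Multiplicative (ℕ →₀ ℤ)) Circle _ _ _ _ χ :=
    continuous_induced_dom
  rw [ContinuousAt, map_one]
  refine tendsto_pi_nhds.2 fun j => ?_
  -- Characters mapping this compact set into the open right half of the circle have |t j| < π/2, so
  -- there t j is the argument of the value at `goldenSeq j 0`, which depends continuously on the
  -- character near 1.
  let K : Set (Multiplicative (ℕ →₀ ℤ)) :=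
    insert 1 (range fun n => Multiplicative.ofAdd (goldenSeq j n))
  have hK : IsCompact K := (h.tendsto_goldenSeq j).isCompact_insert_range
  have hev : ∀ᶠ χ : DualGroup (ℕ →₀ ℤ) in 𝓝 1,
      MapsTo χ K (Circle.centeredArc (Real.pi / 2)) := by
    have h1 := ContinuousMap.eventually_mapsTo (f := @ContinuousMonoidHom.toContinuousMap
      (Multiplicative (ℕ →₀ ℤ)) Circle _ _ _ _ (1 : DualGroup (ℕ →₀ ℤ))) hK
      (Circle.isOpen_centeredArc (Real.pi / 2)) (fun x _ => by
        rw [Circle.mem_centeredArc (by linarith)]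
        change |Complex.arg ((1 : Circle) : ℂ)| < _
        simp [hπ])
    exact (hind.tendsto 1).eventually h1
  have hlim : Tendsto (fun χ : DualGroup (ℕ →₀ ℤ) =>
      Complex.arg (χ (Multiplicative.ofAdd (goldenSeq j 0)))) (𝓝 1) (𝓝 0) := by
    have h1 : Continuous fun χ : DualGroup (ℕ →₀ ℤ) => χ (Multiplicative.ofAdd (goldenSeq j 0)) :=
      (continuous_eval_const (F := C(Multiplicative (ℕ →₀ ℤ), Circle))
        (Multiplicative.ofAdd (goldenSeq j 0))).comp hind
    have h2 : ContinuousAt (fun w : Circle => Complex.arg w) 1 :=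
      (Complex.continuousAt_arg (by simp)).comp continuous_subtype_val.continuousAt
    have h3 := h2.tendsto.comp (h1.tendsto 1)
    simpa [Function.comp_def] using h3
  refine (hlim.congr' ?_)
  filter_upwards [hev] with χ hχ
  obtain ⟨t, rfl⟩ := h.dualEquiv.surjective χ
  rw [h.dualEquiv.symm_apply_apply]
  have hval : ∀ n, h.dualEquiv t (Multiplicative.ofAdd (goldenSeq j n)) =
      Circle.exp (t.toAdd j * Real.goldenConj ^ n) := fun n => by
    rw [← goldenPairing_goldenSeq]
    rfl
  have ht := abs_lt.1 (abs_lt_of_forall_abs_arg_exp_goldenConj (t := t.toAdd j) fun n => by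
    rw [← hval, ← Circle.mem_centeredArc (by linarith)]
    exact hχ (Or.inr ⟨n, rfl⟩))
  rw [hval, pow_zero, mul_one, Circle.arg_exp (by linarith) (by linarith)]
  rfl

end IsCoherent

theorem proposition1p12 :
    ∃ (τ : TopologicalSpace (ℕ →₀ ℤ)) (_ : IsTopologicalAddGroup (ℕ →₀ ℤ)),
      T2Space (ℕ →₀ ℤ) ∧
      IsCompleteAddGroup (ℕ →₀ ℤ) ∧
      SequentialSpace (ℕ →₀ ℤ) ∧
      IsMAP (ℕ →₀ ℤ) ∧
      Nonempty (DualGroup (ℕ →₀ ℤ) ≃ₜ* Multiplicative (ℕ → ℝ)) := by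
  let _ := coherentTopology goldenEmbedding goldenSums
  have h : IsCoherent goldenEmbedding goldenSums := isCoherent_goldenEmbedding
  have hτ : IsTopologicalAddGroup (ℕ →₀ ℤ) :=
    h.isTopologicalAddGroup add_mem_goldenSums neg_mem_goldenSums
  refine ⟨_, hτ, h.t2Space,
    h.isKOmega.isCompleteAddGroup zero_mem_goldenSums add_mem_goldenSums,
    h.sequentialSpace, h.isMAP, ⟨ContinuousMulEquiv.symm
      { h.dualEquiv with
        continuous_toFun := h.continuous_character
        continuous_invFun := h.continuous_dualEquiv_symm }⟩⟩
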